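/- Let $\mathcal{A}$ be a finite family of finite sets that is union-closed (that is, $A\cup B\in\mathcal{A}$ for all $A,B\in\mathcal{A}$), and let its universe $U(\mathcal{A})=\bigcup_{A\in\mathcal{A}}A$ have exactly $m\ge 1$ elements. Suppose that $\mathcal{A}$ is separating: for any two distinct $x,y\in U(\mathcal{A})$ some $A\in\mathcal{A}$ contains exactly one of $x$ and $y$. If $$|\mathcal{A}|\le 2\left(m+\frac{m}{\log_2 m-\log_2\log_2 m}\right),$$ where for $m=1$ the fraction is read as $0$ (its limit as $m\to 1^+$), then some element $x\in U(\mathcal{A})$ lies in at least half of the member sets, i.e. $|\{A\in\mathcal{A}: x\in A\}|\ge \tfrac12|\mathcal{A}|$. -/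

import Mathlib

namespace UnionClosed

/-- The universe of a finite family of finite sets: the union of its member sets. -/
def familyUniverse {α : Type*} [DecidableEq α] (𝒜 : Finset (Finset α)) : Finset α :=
  𝒜.biUnion id

/-- The frequency of `x` in a family: the number of member sets that contain `x`. -/
def frequency {α : Type*} [DecidableEq α] (𝒜 : Finset (Finset α)) (x : α) : ℕ :=
  (𝒜.filter (fun A => x ∈ A)).card

/-- The union of any two member sets is again a member set. -/
def IsUnionClosed {α : Type*} [DecidableEq α] (𝒜 : Finset (Finset α)) : Prop :=
  ∀ A ∈ 𝒜, ∀ B ∈ 𝒜, A ∪ B ∈ 𝒜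

/-- For any two distinct elements of the universe, some member set contains exactly one of
them. -/
def IsSeparating {α : Type*} [DecidableEq α] (𝒜 : Finset (Finset α)) : Prop :=
  ∀ x ∈ familyUniverse 𝒜, ∀ y ∈ familyUniverse 𝒜, x ≠ y →
    ∃ A ∈ 𝒜, (x ∈ A ∧ y ∉ A) ∨ (y ∈ A ∧ x ∉ A)

end UnionClosed

namespace UnionClosed

variable {α : Type*} [DecidableEq α] {𝒜 : Finset (Finset α)}

/-! Suppose each element lies in fewer than half of the `n` members. Take a smallest set `S` of
undominated elements meeting every nonempty member, and let `k = |S|`. Every nonempty subset of `S`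
is then a trace `A ∩ S`, the empty trace occurs at most once, and the full trace occurs at least `m
- k + 1` times (`card_sub_lt_traceCount_self`). This makes the average of `|A ∩ S|` large, while
rarity keeps it below `k / 2`. For `j = k - 2 ≥ 1`, `card_bound_of_traceCount` amounts to `n - 2m ≥
(2m - 2)/j + 2^(j+2) - 2j - 5`. The terms `2m/j` and `2^(j+2)` compete, and the right side exceeds
`2m / logGap m` for every `j` (`logGap_bound`), apart from `k = 3`, `m ≤ 5`, which is left to
`false_of_card_three`. -/

theorem mem_familyUniverse {x : α} : x ∈ familyUniverse 𝒜 ↔ ∃ A ∈ 𝒜, x ∈ A := by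
  simp [familyUniverse]

theorem subset_familyUniverse {A : Finset α} (hA : A ∈ 𝒜) : A ⊆ familyUniverse 𝒜 :=
  fun _ hx => mem_familyUniverse.2 ⟨A, hA, hx⟩

theorem IsUnionClosed.sup_mem (h : IsUnionClosed 𝒜) {ι : Type*} {s : Finset ι}
    (hs : s.Nonempty) {f : ι → Finset α} (hf : ∀ i ∈ s, f i ∈ 𝒜) : s.sup f ∈ 𝒜 := by
  have hc : SupClosed (𝒜 : Set (Finset α)) := fun A hA B hB => h A hA B hB
  exact hc.finsetSup_mem hs hf

theorem IsUnionClosed.familyUniverse_mem (h : IsUnionClosed 𝒜) (hne : 𝒜.Nonempty) :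
    familyUniverse 𝒜 ∈ 𝒜 := by
  rw [familyUniverse, ← Finset.sup_eq_biUnion]
  exact h.sup_mem hne fun A hA => hA

/-! ### Undominated elements and minimal transversals -/

/-- No other element of the universe belongs to all the members that contain `s`. -/
def IsUndominated (𝒜 : Finset (Finset α)) (s : α) : Prop :=
  ∀ y ∈ familyUniverse 𝒜, y ≠ s → ∃ A ∈ 𝒜, s ∈ A ∧ y ∉ A

/-- Every nonempty member of a separating family contains an undominated element. -/
theorem IsSeparating.exists_isUndominated (hsep : IsSeparating 𝒜) {A : Finset α} (hA : A ∈ 𝒜)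
    (hne : A.Nonempty) : ∃ s ∈ A, IsUndominated 𝒜 s := by
  -- A `z` dominating `y` lies in `A`, so by maximality it belongs to the same members as `y`,
  -- against separation.
  obtain ⟨y, hyA, hymax⟩ := Finset.exists_max_image A (frequency 𝒜) hne
  refine ⟨y, hyA, fun z hz hzy => ?_⟩
  by_contra! hcon
  have hzA : z ∈ A := hcon A hA hyA
  have hsub : 𝒜.filter (y ∈ ·) ⊆ 𝒜.filter (z ∈ ·) := fun B hB => by
    rw [Finset.mem_filter] at hB ⊢
    exact ⟨hB.1, hcon B hB.1 hB.2⟩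
  have heq := Finset.eq_of_subset_of_card_le hsub (hymax z hzA)
  obtain ⟨B, hB, ⟨h1, h2⟩ | ⟨h1, h2⟩⟩ := hsep z hz y (subset_familyUniverse hA hyA) hzy
  · exact h2 (Finset.mem_filter.1 (heq ▸ Finset.mem_filter.2 ⟨hB, h1⟩ : B ∈ 𝒜.filter (y ∈ ·))).2
  · exact h2 (hcon B hB h1)

/-- A separating family has a set `S` of undominated elements that meets every nonempty member
and has, for each `s ∈ S`, a member meeting `S` exactly in `s`. -/
theorem IsSeparating.exists_transversal (hsep : IsSeparating 𝒜) :
    ∃ S ⊆ familyUniverse 𝒜, (∀ s ∈ S, IsUndominated 𝒜 s) ∧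
      (∀ A ∈ 𝒜, A.Nonempty → (A ∩ S).Nonempty) ∧ ∀ s ∈ S, ∃ A ∈ 𝒜, A ∩ S = {s} := by
  classical
  let M := (familyUniverse 𝒜).filter (IsUndominated 𝒜)
  let H := M.powerset.filter fun S => ∀ A ∈ 𝒜, A.Nonempty → (A ∩ S).Nonempty
  have hH : H.Nonempty := by
    refine ⟨M, Finset.mem_filter.2 ⟨Finset.mem_powerset_self M, fun A hA hne => ?_⟩⟩
    obtain ⟨s, hs, hsu⟩ := hsep.exists_isUndominated hA hne
    exact ⟨s, Finset.mem_inter.2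
      ⟨hs, Finset.mem_filter.2 ⟨subset_familyUniverse hA hs, hsu⟩⟩⟩
  obtain ⟨S, hS, hmin⟩ := Finset.exists_min_image H Finset.card hH
  obtain ⟨hSM, hhit⟩ := Finset.mem_filter.1 hS
  rw [Finset.mem_powerset] at hSM
  refine ⟨S, hSM.trans (Finset.filter_subset _ _), fun s hs => (Finset.mem_filter.1 (hSM hs)).2,
    hhit, fun s hs => ?_⟩
  -- If no trace is `{s}`, then `S.erase s` still meets every nonempty member, against minimality.
  by_contra! hcon
  have hmem : S.erase s ∈ H := by
    refine Finset.mem_filter.2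
      ⟨Finset.mem_powerset.2 ((Finset.erase_subset _ _).trans hSM), fun A hA hne => ?_⟩
    by_contra hemp
    rw [Finset.not_nonempty_iff_eq_empty] at hemp
    refine hcon A hA (Finset.Subset.antisymm (fun y hy => ?_) ?_)
    · by_contra hys
      rw [Finset.mem_inter] at hy
      rw [Finset.mem_singleton] at hys
      exact Finset.notMem_empty y
        (hemp ▸ Finset.mem_inter.2 ⟨hy.1, Finset.mem_erase.2 ⟨hys, hy.2⟩⟩)
    · obtain ⟨y, hy⟩ := hhit A hA hne
      rw [Finset.mem_inter] at hy
      have : y = s := by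
        by_contra hys
        exact Finset.notMem_empty y
          (hemp ▸ Finset.mem_inter.2 ⟨hy.1, Finset.mem_erase.2 ⟨hys, hy.2⟩⟩)
      subst this
      simpa using hy
  have := hmin _ hmem
  have := Finset.card_erase_lt_of_mem hs
  omega

/-! ### Counting traces on the transversal -/

/-- The number of members whose intersection with `S` is `T`. -/
def traceCount (𝒜 : Finset (Finset α)) (S T : Finset α) : ℕ :=
  (𝒜.filter fun A => A ∩ S = T).card

theorem sum_traceCount_mul (𝒜 : Finset (Finset α)) (S : Finset α) (g : Finset α → ℤ) :
    ∑ T ∈ S.powerset, (traceCount 𝒜 S T : ℤ) * g T = ∑ A ∈ 𝒜, g (A ∩ S) := by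
  rw [← Finset.sum_fiberwise_of_maps_to (s := 𝒜) (t := S.powerset) (g := fun A => A ∩ S)
    fun A _ => Finset.mem_powerset.2 Finset.inter_subset_right]
  refine Finset.sum_congr rfl fun T _ => ?_
  rw [Finset.sum_congr rfl fun A hA => by rw [(Finset.mem_filter.1 hA).2], Finset.sum_const,
    nsmul_eq_mul, traceCount]

theorem sum_frequency (𝒜 : Finset (Finset α)) (S : Finset α) :
    ∑ s ∈ S, frequency 𝒜 s = ∑ A ∈ 𝒜, (A ∩ S).card := by
  simp only [frequency, Finset.card_filter]
  rw [Finset.sum_comm]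
  refine Finset.sum_congr rfl fun A _ => ?_
  rw [← Finset.card_filter, Finset.inter_comm, Finset.filter_mem_eq_inter]

theorem two_mul_sum_powerset_card_sub_one (S : Finset α) :
    2 * ∑ T ∈ S.powerset, ((T.card : ℤ) - 1) = (S.card - 2) * 2 ^ S.card := by
  induction S using Finset.induction_on with
  | empty => simp
  | insert a S ha ih =>
    rw [Finset.sum_powerset_insert ha, Finset.card_insert_of_notMem ha]
    have h : ∑ T ∈ S.powerset, (((insert a T).card : ℤ) - 1) =
        ∑ T ∈ S.powerset, ((T.card : ℤ) - 1) + 2 ^ S.card := by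
      rw [Finset.sum_congr rfl fun T hT => by
        rw [Finset.card_insert_of_notMem fun h => ha (Finset.mem_powerset.1 hT h)]]
      push_cast
      simp only [Finset.sum_sub_distrib, Finset.sum_add_distrib, Finset.sum_const,
        Finset.card_powerset, nsmul_eq_mul]
      push_cast
      ring
    rw [h]
    push_cast
    rw [pow_succ]
    linarith

theorem traceCount_empty_le_one {S : Finset α}
    (hhit : ∀ A ∈ 𝒜, A.Nonempty → (A ∩ S).Nonempty) : traceCount 𝒜 S ∅ ≤ 1 := by
  refine Finset.card_le_one.2 fun A hA B hB => ?_
  have key : ∀ A ∈ 𝒜.filter (fun A => A ∩ S = ∅), A = ∅ := fun A hA => by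
    by_contra hne
    rw [Finset.mem_filter] at hA
    exact (hhit A hA.1 (Finset.nonempty_iff_ne_empty.2 hne)).ne_empty hA.2
  rw [key A hA, key B hB]

/-- The union over `s ∈ T` of members with trace `{s}` has trace `T`. -/
theorem IsUnionClosed.one_le_traceCount (hunion : IsUnionClosed 𝒜) {S T : Finset α}
    (hpriv : ∀ s ∈ S, ∃ A ∈ 𝒜, A ∩ S = {s}) (hT : T ⊆ S) (hne : T.Nonempty) :
    1 ≤ traceCount 𝒜 S T := by
  choose! f hf hfS using hpriv
  refine Finset.card_pos.2 ⟨T.sup f, Finset.mem_filter.2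
    ⟨hunion.sup_mem hne fun s hs => hf s (hT hs), ?_⟩⟩
  have h (s) (hs : s ∈ S) (x) : (x ∈ f s ∧ x ∈ S) ↔ x = s := by
    rw [← Finset.mem_inter, hfS s hs, Finset.mem_singleton]
  ext x
  rw [Finset.mem_inter, Finset.mem_sup]
  constructor
  · rintro ⟨⟨s, hs, hx⟩, hxS⟩
    exact ((h s (hT hs) x).1 ⟨hx, hxS⟩) ▸ hs
  · intro hx
    have := (h x (hT hx) x).2 rfl
    exact ⟨⟨x, hx, this.1⟩, this.2⟩

/-- The union of the members that avoid `x`. -/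
def avoiding (𝒜 : Finset (Finset α)) (x : α) : Finset α :=
  (𝒜.filter (x ∉ ·)).sup id

theorem mem_avoiding {x y : α} : y ∈ avoiding 𝒜 x ↔ ∃ A ∈ 𝒜, x ∉ A ∧ y ∈ A := by
  simp [avoiding, Finset.mem_sup, and_assoc]

/-- For `x ∉ S`, the member `avoiding 𝒜 x` contains `S` because no `s ∈ S` is dominated by `x`.
Separation makes these members distinct, and the universe is one more. -/
theorem card_sub_lt_traceCount_self (hunion : IsUnionClosed 𝒜) (hsep : IsSeparating 𝒜)
    {S : Finset α} (hSU : S ⊆ familyUniverse 𝒜) (hund : ∀ s ∈ S, IsUndominated 𝒜 s)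
    (hmiss : ∀ x ∈ familyUniverse 𝒜, ∃ A ∈ 𝒜, x ∉ A) (hne : 𝒜.Nonempty) :
    (familyUniverse 𝒜).card - S.card + 1 ≤ traceCount 𝒜 S S := by
  have hU := hunion.familyUniverse_mem hne
  have hself (x : α) : x ∉ avoiding 𝒜 x := fun h => by
    obtain ⟨A, -, h1, h2⟩ := mem_avoiding.1 h
    exact h1 h2
  have hinj : Set.InjOn (avoiding 𝒜) (familyUniverse 𝒜 \ S : Finset α) := by
    intro x hx y hy hxy
    by_contra hne
    rw [Finset.mem_coe, Finset.mem_sdiff] at hx hy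
    obtain ⟨B, hB, ⟨h1, h2⟩ | ⟨h1, h2⟩⟩ := hsep x hx.1 y hy.1 hne
    · exact hself x (hxy ▸ mem_avoiding.2 ⟨B, hB, h2, h1⟩)
    · exact hself y (hxy ▸ mem_avoiding.2 ⟨B, hB, h2, h1⟩)
  have hnot : familyUniverse 𝒜 ∉ (familyUniverse 𝒜 \ S).image (avoiding 𝒜) := fun h => by
    obtain ⟨x, hx, hxU⟩ := Finset.mem_image.1 h
    exact hself x (hxU ▸ (Finset.mem_sdiff.1 hx).1)
  rw [← Finset.card_sdiff_of_subset hSU, ← Finset.card_image_of_injOn hinj,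
    ← Finset.card_insert_of_notMem hnot]
  refine Finset.card_le_card fun A hA => ?_
  rw [Finset.mem_filter]
  rcases Finset.mem_insert.1 hA with rfl | hA
  · exact ⟨hU, Finset.inter_eq_right.2 hSU⟩
  · obtain ⟨x, hx, rfl⟩ := Finset.mem_image.1 hA
    rw [Finset.mem_sdiff] at hx
    refine ⟨hunion.sup_mem ?_ fun A hA => (Finset.mem_filter.1 hA).1,
      Finset.inter_eq_right.2 fun s hs => ?_⟩
    · obtain ⟨A, hA, hxA⟩ := hmiss x hx.1
      exact ⟨A, Finset.mem_filter.2 ⟨hA, hxA⟩⟩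
    · obtain ⟨A, hA, h1, h2⟩ := hund s hs x hx.1 fun h => hx.2 (h ▸ hs)
      exact mem_avoiding.2 ⟨A, hA, h2, h1⟩

/-- The counting inequality for a transversal `S` none of whose elements is abundant. -/
theorem card_bound_of_traceCount {S : Finset α} {m : ℕ} (hSne : S.Nonempty)
    (h0 : traceCount 𝒜 S ∅ ≤ 1)
    (h1 : ∀ T ⊆ S, T.Nonempty → 1 ≤ traceCount 𝒜 S T)
    (hS : m - S.card + 1 ≤ traceCount 𝒜 S S)
    (hrare : ∀ s ∈ S, 2 * frequency 𝒜 s + 1 ≤ 𝒜.card) :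
    2 * (𝒜.card : ℤ) + (S.card - 2) * 2 ^ S.card + 2 * ((S.card - 1) * (m - S.card)) ≤
      S.card * (𝒜.card - 1) := by
  have hk := hSne.card_pos
  have hup : 2 * ∑ A ∈ 𝒜, ((A ∩ S).card : ℤ) ≤ S.card * (𝒜.card - 1) := by
    rw [← Nat.cast_sum, ← sum_frequency, Nat.cast_sum, Finset.mul_sum, ← nsmul_eq_mul]
    refine Finset.sum_le_card_nsmul _ _ _ fun s hs => ?_
    have := hrare s hs
    lia
  have hsplit : ∑ A ∈ 𝒜, (((A ∩ S).card : ℤ) - 1) = ∑ A ∈ 𝒜, ((A ∩ S).card : ℤ) - 𝒜.card := by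
    simp
  -- The weight `|T| - 1` is negative only at `∅`, where the count is at most one; elsewhere lower
  -- bounds on the counts suffice.
  have hlow : ∑ T ∈ S.powerset, ((T.card : ℤ) - 1) + (S.card - 1) * (m - S.card) ≤
      ∑ A ∈ 𝒜, (((A ∩ S).card : ℤ) - 1) := by
    rw [← sum_traceCount_mul 𝒜 S fun T => (T.card : ℤ) - 1,
      ← Finset.add_sum_erase _ _ (Finset.mem_powerset_self S),
      ← Finset.add_sum_erase _ _ (Finset.mem_powerset_self S)]
    have hterm : ∑ T ∈ S.powerset.erase S, ((T.card : ℤ) - 1) ≤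
        ∑ T ∈ S.powerset.erase S, (traceCount 𝒜 S T : ℤ) * ((T.card : ℤ) - 1) := by
      refine Finset.sum_le_sum fun T hT => ?_
      rw [Finset.mem_erase, Finset.mem_powerset] at hT
      rcases T.eq_empty_or_nonempty with rfl | hTne
      · simp only [Finset.card_empty]
        lia
      · have := h1 T hT.2 hTne
        have := hTne.card_pos
        nlinarith
    have : ((m : ℤ) - S.card + 1) * (S.card - 1) ≤ traceCount 𝒜 S S * ((S.card : ℤ) - 1) :=
      mul_le_mul_of_nonneg_right (by lia) (by lia)
    linarith
  have := two_mul_sum_powerset_card_sub_one S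
  linarith

/-! ### Transversals of size three in small universes -/

theorem image_sdiff_trace_subset {S T : Finset α} :
    (𝒜.filter fun A => A ∩ S = T).image (· \ S) ⊆ (familyUniverse 𝒜 \ S).powerset := by
  intro B hB
  obtain ⟨A, hA, rfl⟩ := Finset.mem_image.1 hB
  exact Finset.mem_powerset.2
    (Finset.sdiff_subset_sdiff (subset_familyUniverse (Finset.mem_filter.1 hA).1) subset_rfl)

theorem card_image_sdiff_trace (𝒜 : Finset (Finset α)) (S T : Finset α) :
    ((𝒜.filter fun A => A ∩ S = T).image (· \ S)).card = traceCount 𝒜 S T := by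
  refine Finset.card_image_of_injOn fun A hA B hB hAB => ?_
  rw [Finset.mem_coe, Finset.mem_filter] at hA hB
  rw [← Finset.sdiff_union_inter A S, ← Finset.sdiff_union_inter B S, hA.2, hB.2]
  exact congrArg (· ∪ T) hAB

theorem traceCount_le_two_pow {S T : Finset α} :
    traceCount 𝒜 S T ≤ 2 ^ (familyUniverse 𝒜 \ S).card := by
  rw [← card_image_sdiff_trace, ← Finset.card_powerset]
  exact Finset.card_le_card image_sdiff_trace_subset

theorem exists_trace_of_traceCount_eq {S T R : Finset α}
    (h : traceCount 𝒜 S T = 2 ^ (familyUniverse 𝒜 \ S).card) (hR : R ⊆ familyUniverse 𝒜 \ S) :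
    ∃ A ∈ 𝒜, A ∩ S = T ∧ A \ S = R := by
  have heq := Finset.eq_of_subset_of_card_le (image_sdiff_trace_subset (𝒜 := 𝒜) (S := S) (T := T))
    (by rw [card_image_sdiff_trace, h, Finset.card_powerset])
  obtain ⟨A, hA, rfl⟩ := Finset.mem_image.1 (heq ▸ Finset.mem_powerset.2 hR)
  rw [Finset.mem_filter] at hA
  exact ⟨A, hA.1, hA.2, rfl⟩

/-- A full fibre over `T` has members that are empty and full outside `S`; joining each to a member
of trace `T'` that is empty outside `S` keeps them distinct. -/
theorem IsUnionClosed.two_le_traceCount_union (hunion : IsUnionClosed 𝒜) {S T T' : Finset α}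
    (hne : (familyUniverse 𝒜 \ S).Nonempty)
    (h : traceCount 𝒜 S T = 2 ^ (familyUniverse 𝒜 \ S).card)
    (h' : traceCount 𝒜 S T' = 2 ^ (familyUniverse 𝒜 \ S).card) :
    2 ≤ traceCount 𝒜 S (T ∪ T') := by
  obtain ⟨A, hA, hAT, hAR⟩ := exists_trace_of_traceCount_eq h (Finset.empty_subset _)
  obtain ⟨B, hB, hBT, hBR⟩ := exists_trace_of_traceCount_eq h subset_rfl
  obtain ⟨C, hC, hCT, hCR⟩ := exists_trace_of_traceCount_eq h' (Finset.empty_subset _)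
  refine Finset.one_lt_card.2 ⟨A ∪ C, ?_, B ∪ C, ?_, fun heq => ?_⟩
  · exact Finset.mem_filter.2 ⟨hunion A hA C hC, by rw [Finset.union_inter_distrib_right, hAT, hCT]⟩
  · exact Finset.mem_filter.2 ⟨hunion B hB C hC, by rw [Finset.union_inter_distrib_right, hBT, hCT]⟩
  · have := congrArg (· \ S) heq
    simp only [Finset.union_sdiff_distrib, hAR, hBR, hCR, Finset.union_empty] at this
    exact hne.ne_empty this.symm

/-- A transversal with three elements in a universe of at most five contains an abundant
element. -/
theorem IsUnionClosed.false_of_card_three (hunion : IsUnionClosed 𝒜) {S : Finset α}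
    (hS3 : S.card = 3) (hSU : S ⊆ familyUniverse 𝒜) (hm : (familyUniverse 𝒜).card ≤ 5)
    (h0 : traceCount 𝒜 S ∅ ≤ 1) (h1 : ∀ T ⊆ S, T.Nonempty → 1 ≤ traceCount 𝒜 S T)
    (hS : (familyUniverse 𝒜).card - S.card + 1 ≤ traceCount 𝒜 S S)
    (hrare : ∀ s ∈ S, 2 * frequency 𝒜 s + 1 ≤ 𝒜.card) : False := by
  have h3 := Finset.card_le_card hSU
  have hR := Finset.card_sdiff_of_subset hSU
  have hle (T) := traceCount_le_two_pow (𝒜 := 𝒜) (S := S) (T := T)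
  have htwo (T T') := hunion.two_le_traceCount_union (S := S) (T := T) (T' := T')
  -- The weights by trace size are `-3, -1, 1, 3`, so the singleton counts must total at least `3m -
  -- 3`, yet each is at most `2^(m-3)`.
  have hup : ∑ A ∈ 𝒜, (2 * ((A ∩ S).card : ℤ) - 3) ≤ -3 := by
    have : 2 * ∑ A ∈ 𝒜, ((A ∩ S).card : ℤ) ≤ S.card * (𝒜.card - 1) := by
      rw [← Nat.cast_sum, ← sum_frequency, Nat.cast_sum, Finset.mul_sum, ← nsmul_eq_mul]
      refine Finset.sum_le_card_nsmul _ _ _ fun s hs => ?_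
      have := hrare s hs
      lia
    rw [hS3] at this
    rw [Finset.sum_sub_distrib, ← Finset.mul_sum]
    simp only [Finset.sum_const, nsmul_eq_mul]
    push_cast at this
    linarith
  rw [← sum_traceCount_mul 𝒜 S fun T => 2 * (T.card : ℤ) - 3] at hup
  rw [hS3] at hS
  obtain ⟨x, y, z, hxy, hxz, hyz, hxyz⟩ := Finset.card_eq_three.1 hS3
  have hexp (g : Finset α → ℤ) : ∑ T ∈ S.powerset, g T =
      g ∅ + (g {x} + g {y} + g {z}) + (g {x, y} + g {x, z} + g {y, z}) + g S := by
    have hsing (g : Finset α → ℤ) : ∑ T ∈ ({z} : Finset α).powerset, g T = g ∅ + g {z} := by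
      rw [← insert_empty_eq z, Finset.sum_powerset_insert (Finset.notMem_empty z)]
      simp
    rw [hxyz, Finset.sum_powerset_insert (by simp [hxy, hxz]),
      Finset.sum_powerset_insert (by simp [hyz]), Finset.sum_powerset_insert (by simp [hyz]),
      hsing, hsing, hsing, hsing, insert_empty_eq, insert_empty_eq]
    ring
  rw [hexp, hS3] at hup
  simp only [Finset.card_empty, Finset.card_singleton, Finset.card_pair hxy,
    Finset.card_pair hxz, Finset.card_pair hyz] at hup
  have hx := hle {x}
  have hy := hle {y}
  have hz := hle {z}
  have hxy1 := h1 {x, y} (by simp [hxyz, Finset.insert_subset_iff]) (by simp)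
  have hxz1 := h1 {x, z} (by simp [hxyz, Finset.insert_subset_iff]) (by simp)
  have hyz1 := h1 {y, z} (by simp [hxyz]) (by simp)
  have hxy2 := htwo {x} {y}
  rw [show ({x} ∪ {y} : Finset α) = {x, y} from rfl] at hxy2
  rw [hS3] at hR
  obtain hm | hm | hm : (familyUniverse 𝒜).card = 3 ∨ (familyUniverse 𝒜).card = 4 ∨
      (familyUniverse 𝒜).card = 5 := by lia
  all_goals
    rw [hm] at hR hS
    rw [hR] at hx hy hz hxy2
    norm_num at hx hy hz hxy2 hS hup
  · lia
  · lia
  -- For `m = 5` equality is forced: all singleton fibres are full and each pair occurs once, but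
  -- full fibres give `{x, y}` twice.
  · have := hxy2 (Finset.card_pos.1 (by lia)) (by lia) (by lia)
    lia

/-! ### Estimates for `logGap` -/

open Real

/-- The denominator `log₂ m - log₂ log₂ m` of the cardinality bound. -/
noncomputable def logGap (m : ℕ) : ℝ := logb 2 m - logb 2 (logb 2 m)

theorem logGap_eq {m : ℕ} (hm : 2 ≤ m) : logGap m = logb 2 (m / logb 2 m) := by
  have hm' : (1 : ℝ) < m := by exact_mod_cast hm
  rw [logGap, logb_div (by positivity) (logb_pos one_lt_two hm').ne']

/-- Reduces rational lower bounds to integer arithmetic: `m / log₂ m ≥ r / s ≥ 2^(p/q)`. -/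
theorem le_logGap {m p q r s : ℕ} (hm : 2 ≤ m) (hq : 0 < q) (hr : 0 < r) (hs : 0 < s)
    (hc : 2 ^ p * s ^ q ≤ r ^ q) (h : m ^ r ≤ 2 ^ (s * m)) : (p / q : ℝ) ≤ logGap m := by
  have hm' : (1 : ℝ) < m := by exact_mod_cast hm
  have hl := logb_pos one_lt_two hm'
  have hq' : (0 : ℝ) < q := by exact_mod_cast hq
  have hr' : (0 : ℝ) < r := by exact_mod_cast hr
  have hs' : (0 : ℝ) < s := by exact_mod_cast hs
  rw [logGap_eq hm]
  have h1 : (r : ℝ) / s ≤ m / logb 2 m := by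
    rw [div_le_div_iff₀ hs' hl]
    have h2 : ((m : ℝ) ^ r) ≤ 2 ^ (s * m) := by exact_mod_cast h
    have h3 := logb_le_logb_of_le one_lt_two (by positivity) h2
    rw [logb_pow, logb_pow, logb_self_eq_one one_lt_two] at h3
    push_cast at h3
    linarith
  have h2 : (p : ℝ) ≤ q * logb 2 (r / s) := by
    rw [← logb_pow, le_logb_iff_rpow_le one_lt_two (by positivity), div_pow,
      le_div_iff₀ (by positivity), rpow_natCast]
    exact_mod_cast hc
  have h3 := logb_le_logb_of_le one_lt_two (by positivity) h1
  rw [div_le_iff₀ hq']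
  nlinarith

theorem one_le_logGap {m : ℕ} (hm : 4 ≤ m) : 1 ≤ logGap m := by
  have h : m ^ 2 ≤ 2 ^ (1 * m) := by
    rw [one_mul]
    induction m, hm using Nat.le_induction with
    | base => norm_num
    | succ m hm ih => rw [pow_succ 2]; nlinarith
  simpa using le_logGap (p := 1) (q := 1) (by lia) one_pos two_pos one_pos (by norm_num) h

theorem seven_sixths_le_logGap {m : ℕ} (hm : 6 ≤ m) (hm' : m ≤ 15) : 7 / 6 ≤ logGap m := by
  have h : m ^ 9 ≤ 2 ^ (4 * m) := by interval_cases m <;> norm_num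
  simpa using le_logGap (p := 7) (q := 6) (r := 9) (s := 4) (by lia) (by norm_num)
    (by norm_num) (by norm_num) (by norm_num) h

theorem three_halves_le_logGap {m : ℕ} (hm : 9 ≤ m) (hm' : m ≤ 15) : 3 / 2 ≤ logGap m := by
  have h : m ^ 17 ≤ 2 ^ (6 * m) := by interval_cases m <;> norm_num
  simpa using le_logGap (p := 3) (q := 2) (r := 17) (s := 6) (by lia) (by norm_num)
    (by norm_num) (by norm_num) (by norm_num) h

theorem four_le_logb {m : ℕ} (hm : 16 ≤ m) : 4 ≤ logb 2 m := by
  rw [le_logb_iff_rpow_le one_lt_two (by positivity)]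
  have : (16 : ℝ) ≤ m := by exact_mod_cast hm
  norm_num
  linarith

theorem sq_le_two_rpow {x : ℝ} (hx : 4 ≤ x) : x ^ 2 ≤ 2 ^ x := by
  have h1 : log x ≤ log 4 + (x / 4 - 1) := by
    have := log_le_sub_one_of_pos (show 0 < x / 4 by positivity)
    rw [log_div (by positivity) (by norm_num)] at this
    linarith
  have h2 : log 4 = 2 * log 2 := by
    rw [show (4 : ℝ) = 2 ^ 2 by norm_num, log_pow]; norm_num
  have h3 := log_two_gt_d9
  rw [← log_le_log_iff (by positivity) (by positivity), log_pow, log_rpow two_pos]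
  push_cast
  nlinarith

theorem half_logb_le_logGap {m : ℕ} (hm : 16 ≤ m) : logb 2 m / 2 ≤ logGap m := by
  have hl := four_le_logb hm
  have h := logb_le_logb_of_le one_lt_two (by positivity) (sq_le_two_rpow hl)
  rw [logb_rpow two_pos (by norm_num), logb_pow] at h
  rw [logGap]
  push_cast at h
  linarith

theorem two_pow_ge {j : ℕ} (hj : 3 ≤ j) : 2 * j ^ 2 + 9 * j + 15 ≤ 2 * 2 ^ (j + 2) := by
  induction j, hj using Nat.le_induction with
  | base => norm_num
  | succ j hj ih => rw [show j + 1 + 2 = j + 2 + 1 by ring, pow_succ 2 (j + 2)]; nlinarith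

theorem logGap_bound_large {m j : ℕ} (hm : 16 ≤ m) (hj : 1 ≤ j) :
    2 * (m : ℝ) / logGap m < (2 * m - 2) / j + 2 ^ (j + 2) - 2 * j - 5 := by
  have hm' : (16 : ℝ) ≤ m := by exact_mod_cast hm
  have hl := four_le_logb hm
  have hL := half_logb_le_logGap hm
  have hLpos : 0 < logGap m := by linarith
  have hm2 : 2 * (m : ℝ) / logGap m ≤ m := by
    rw [div_le_iff₀ hLpos]; nlinarith
  have hj' : (1 : ℝ) ≤ j := by exact_mod_cast hj
  rcases Nat.lt_or_ge j 2 with h | hj2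
  · obtain rfl : j = 1 := by lia
    norm_num
    linarith
  have hj2' : (2 : ℝ) ≤ j := by exact_mod_cast hj2
  -- If `j ≤ logGap m`, the term `2m/j` suffices. Otherwise `2^j > m / log₂ m`, and `logGap m ≥ log₂
  -- m / 2` gives `2m / logGap m < 2^(j+2)`.
  rcases le_or_gt (j : ℝ) (logGap m) with hjL | hjL
  · have h1 : 2 * (m : ℝ) / logGap m ≤ 2 * m / j := by gcongr
    have h2 : (2 * (m : ℝ) - 2) / j = 2 * m / j - 2 / j := by ring
    have h3 : (2 : ℝ) / j ≤ 1 := by rw [div_le_one (by positivity)]; exact hj2'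
    have h4 : (2 * j + 7 : ℝ) ≤ 2 ^ (j + 2) := by
      have : 2 * j + 7 ≤ 2 ^ (j + 2) := by
        clear hjL h1 h2 h3 hj2' hj'
        induction j, hj2 using Nat.le_induction with
        | base => norm_num
        | succ j hj ih => rw [show j + 1 + 2 = j + 2 + 1 by ring, pow_succ]; lia
      exact_mod_cast this
    linarith
  · rcases le_or_gt (2 * (j : ℝ) + 5) ((2 * m - 2) / j) with hb | hb
    · have h1 : (m : ℝ) / logb 2 m < 2 ^ j := by
        rw [logGap_eq (by lia), logb_lt_iff_lt_rpow one_lt_two (by positivity),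
          rpow_natCast] at hjL
        exact hjL
      have h2 : 2 * (m : ℝ) / logGap m ≤ 4 * (m / logb 2 m) := by
        rw [← mul_div_assoc, div_le_div_iff₀ hLpos (by linarith)]
        nlinarith
      rw [pow_add]
      linarith
    -- Here `m` is at most quadratic in `j`, so `2^(j+2)` beats `m ≥ 2m / logGap m`.
    · rw [div_lt_iff₀ (by positivity)] at hb
      have hj3 : 3 ≤ j := by
        by_contra hcon
        obtain rfl : j = 2 := by lia
        norm_num at hb
        linarith
      have h1 : (2 * j ^ 2 + 9 * j + 15 : ℝ) ≤ 2 * 2 ^ (j + 2) := by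
        exact_mod_cast two_pow_ge hj3
      have h2 : 0 ≤ (2 * (m : ℝ) - 2) / j := div_nonneg (by linarith) (by positivity)
      nlinarith

theorem logGap_bound_small {m j : ℕ} (hm : 4 ≤ m) (hm' : m ≤ 15) (hj : 1 ≤ j)
    (hjm : j = 1 → 6 ≤ m) :
    2 * (m : ℝ) / logGap m < (2 * m - 2) / j + 2 ^ (j + 2) - 2 * j - 5 := by
  have h4 : (4 : ℝ) ≤ m := by exact_mod_cast hm
  have h15 : (m : ℝ) ≤ 15 := by exact_mod_cast hm'
  have hL := one_le_logGap hm
  have key {c : ℝ} (hc : 0 < c) (h : c ≤ logGap m) : 2 * (m : ℝ) / logGap m ≤ 2 * m / c := by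
    gcongr
  have hk := key one_pos hL
  rcases Nat.lt_or_ge j 4 with hj4 | hj4
  · interval_cases j
    · have h6 : (6 : ℝ) ≤ m := by exact_mod_cast hjm rfl
      have := key (by norm_num) (seven_sixths_le_logGap (hjm rfl) hm')
      norm_num
      linarith
    · norm_num
      rcases Nat.lt_or_ge m 6 with h6 | h6
      · have : (m : ℝ) < 6 := by exact_mod_cast h6
        linarith
      rcases Nat.lt_or_ge m 9 with h9 | h9
      · have : (m : ℝ) ≤ 8 := by exact_mod_cast Nat.lt_succ_iff.1 h9
        have := key (by norm_num) (seven_sixths_le_logGap h6 hm')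
        linarith
      · have := key (by norm_num) (three_halves_le_logGap h9 hm')
        linarith
    · norm_num
      linarith
  · have h2 : 0 ≤ (2 * (m : ℝ) - 2) / j := div_nonneg (by linarith) (by positivity)
    have h3 : (2 * j + 36 : ℝ) ≤ 2 ^ (j + 2) := by
      have : 2 * j + 36 ≤ 2 ^ (j + 2) := by
        clear h2 hjm hj
        induction j, hj4 using Nat.le_induction with
        | base => norm_num
        | succ j hj ih => rw [show j + 1 + 2 = j + 2 + 1 by ring, pow_succ]; lia
      exact_mod_cast this
    linarith

theorem logGap_bound {m j : ℕ} (hm : 4 ≤ m) (hj : 1 ≤ j) (hjm : j = 1 → 6 ≤ m) :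
    2 * (m : ℝ) / logGap m < (2 * m - 2) / j + 2 ^ (j + 2) - 2 * j - 5 := by
  rcases le_or_gt m 15 with h | h
  · exact logGap_bound_small hm h hj hjm
  · exact logGap_bound_large h hj

end UnionClosed

/-! ### The main theorem -/

open UnionClosed in
theorem mainTheorem1 {α : Type*} [DecidableEq α] (𝒜 : Finset (Finset α)) (m : ℕ)
    (hunion : UnionClosed.IsUnionClosed 𝒜) (hsep : UnionClosed.IsSeparating 𝒜)
    (hm : (UnionClosed.familyUniverse 𝒜).card = m) (hpos : 1 ≤ m)
    (hcard : (𝒜.card : ℝ) ≤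
      2 * ((m : ℝ) + (m : ℝ) / (Real.logb 2 (m : ℝ) - Real.logb 2 (Real.logb 2 (m : ℝ))))) :
    ∃ x ∈ UnionClosed.familyUniverse 𝒜,
      (𝒜.card : ℝ) / 2 ≤ (UnionClosed.frequency 𝒜 x : ℝ) := by
  by_contra! hcon
  have hrare (x) (hx : x ∈ familyUniverse 𝒜) : 2 * frequency 𝒜 x + 1 ≤ 𝒜.card := by
    have h := hcon x hx
    rw [lt_div_iff₀ two_pos] at h
    have : frequency 𝒜 x * 2 < 𝒜.card := by exact_mod_cast h
    lia
  obtain ⟨u, hu⟩ := Finset.card_pos.1 (hm ▸ hpos : 0 < (familyUniverse 𝒜).card)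
  obtain ⟨A, hA, huA⟩ := mem_familyUniverse.1 hu
  have hmiss (x) (hx : x ∈ familyUniverse 𝒜) : ∃ A ∈ 𝒜, x ∉ A := by
    by_contra! hall
    have h := hrare x hx
    rw [frequency, Finset.filter_true_of_mem hall] at h
    lia
  obtain ⟨S, hSU, hund, hhit, hpriv⟩ := hsep.exists_transversal
  obtain ⟨s, hs⟩ := hhit A hA ⟨u, huA⟩
  have hSne : S.Nonempty := ⟨s, (Finset.mem_inter.1 hs).2⟩
  have h0 := traceCount_empty_le_one hhit
  have h1 (T) (hT : T ⊆ S) (hne : T.Nonempty) := hunion.one_le_traceCount hpriv hT hne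
  have hS := card_sub_lt_traceCount_self hunion hsep hSU hund hmiss ⟨A, hA⟩
  have hkm := Finset.card_le_card hSU
  rw [hm] at hkm
  have hbound := card_bound_of_traceCount hSne h0 h1 (hm ▸ hS) fun s hs => hrare s (hSU hs)
  have hn := hrare u hu
  have hfu : 0 < frequency 𝒜 u := Finset.card_pos.2 ⟨A, Finset.mem_filter.2 ⟨hA, huA⟩⟩
  have hk := hSne.card_pos
  -- For `k ≤ 2` the counting inequality is already contradictory; this covers `m = 1`.
  rcases Nat.lt_or_ge S.card 3 with hk3 | hk3
  · obtain h | h : S.card = 1 ∨ S.card = 2 := by lia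
    all_goals rw [h] at hbound hkm; norm_num at hbound; lia
  by_cases hsmall : S.card = 3 ∧ m ≤ 5
  · exact hunion.false_of_card_three hsmall.1 hSU (hm ▸ hsmall.2) h0 h1 hS
      fun s hs => hrare s (hSU hs)
  -- Now `j = k - 3`, so the estimate is applied at `j + 1 = k - 2`.
  obtain ⟨j, hj⟩ := Nat.exists_eq_add_of_le hk3
  have hgap := logGap_bound (m := m) (j := j + 1) (by lia) (by lia) (by lia)
  have hj' : S.card = j + 1 + 2 := by lia
  have hboundR : 2 * (𝒜.card : ℝ) + (S.card - 2) * 2 ^ S.card +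
      2 * ((S.card - 1) * (m - S.card)) ≤ S.card * (𝒜.card - 1) := by exact_mod_cast hbound
  rw [hj'] at hboundR
  have hjpos : (0 : ℝ) < (j + 1 : ℕ) := by positivity
  have hle : (2 * (m : ℝ) - 2) / (j + 1 : ℕ) + 2 ^ (j + 1 + 2) - 2 * (j + 1 : ℕ) - 5 ≤
      𝒜.card - 2 * m := by
    have : (2 * (m : ℝ) - 2) / (j + 1 : ℕ) ≤
        𝒜.card - 2 * m - 2 ^ (j + 1 + 2) + 2 * (j + 1 : ℕ) + 5 := by
      rw [div_le_iff₀ hjpos]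
      push_cast at hboundR ⊢
      linarith
    linarith
  have : (𝒜.card : ℝ) ≤ 2 * (m + m / logGap m) := hcard
  rw [mul_add, ← mul_div_assoc] at this
  linarith
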